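/- Let $\mathfrak g$ be a finite-dimensional simple complex Lie algebra, $\mathfrak h\subset\mathfrak g$ a Cartan subalgebra, and $\mathfrak l\supset\mathfrak h$ a Levi subalgebra, i.e. $\mathfrak l$ is generated by $\mathfrak h$ and the root spaces $\mathfrak g_{\pm\alpha}$, $\alpha\in\Gamma$, for some subset $\Gamma$ of some set of simple roots. Let $\Omega_{\mathfrak l}\subset\Omega\subset\mathfrak h^*$ be the sets of roots of $\mathfrak l$ and of $\mathfrak g$. The set $\overline\Omega$ of quasiroots is the set of nonzero elements of the image of $\Omega$ in $\mathfrak h^*/\mathrm{span}_{\mathbb C}(\Omega_{\mathfrak l})$. A system of positive quasiroots is a subset $Y\subset\overline\Omega$ such that $Y\cap(-Y)=\varnothing$, $Y\cup(-Y)=\overline\Omega$, and $\alpha+\beta\in Y$ whenever $\alpha,\beta\in Y$ and $\alpha+\beta\in\overline\Omega$. A corresponding set of simple quasiroots is a subset $P\subset Y$ such that every element of $Y$ is uniquely a linear combination of elements of $P$ with nonnegative integer coefficients. For $K\in\mathbb C$ let $X_{K^2}\subset\mathbb C^{\overline\Omega}$ be the affine algebraic variety of all families $(c(\alpha))_{\alpha\in\overline\Omega}$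 with $c(-\alpha)=-c(\alpha)$ for all $\alpha\in\overline\Omega$ and $$c(\alpha+\beta)\,(c(\alpha)+c(\beta))=c(\alpha)c(\beta)+K^2\qquad\text{whenever }\alpha,\beta,\alpha+\beta\in\overline\Omega .$$ Let $K\neq0$. Then: a) For every $c\in X_{K^2}$ there are a system of positive quasiroots $Y$ and a corresponding set of simple quasiroots $P$ such that $c$ is obtained recursively from its values on $P$. That is, consider the procedure which starts with the values $c(\alpha)$, $\alpha\in P$, and which, from a value $x$ found at $\alpha$ and a value $y$ found at $\beta$ with $\alpha+\beta\in\overline\Omega$, produces the value $(xy+K^2)/(x+y)$ at $\alpha+\beta$; then no denominator $x+y$ occurring in it vanishes, and it reaches every $\alpha\in Y$, giving there the value $c(\alpha)$ and no other. b) The variety $X_{K^2}$ is nonsingular (all local rings of its coordinate ring $\mathbb C[X_{K^2}]$ are regular) and connected (nonempty and connected in the Euclidean topology, hence also in the Zariski topology), and its dimension (the Krull dimension of $\mathbb C[X_{K^2}]$) equals the number of elements of $P$, for every set $P$ of simple quasiroots corresponding to any system of positive quasiroots. -/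

import Mathlib

open LieAlgebra LieModule

noncomputable section

namespace PhiBracket

section Abstract

variable {V : Type*} [AddCommGroup V]

/-- A subset `Y` of `Q` is semilinear if it is closed under those sums that stay in `Q`,
`Y ∩ (-Y) = ∅` and `Y ∪ (-Y) = Q`. -/
structure IsSemilinear {Q : Set V} (Y : Set Q) : Prop where
  add_mem : ∀ α β γ : Q, α ∈ Y → β ∈ Y → (γ : V) = α + β → γ ∈ Y
  neg_notMem : ∀ α β : Q, α ∈ Y → (β : V) = -α → β ∉ Y
  mem_or_neg_mem : ∀ α : Q, α ∈ Y ∨ ∃ β ∈ Y, (β : V) = -α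

/-- `P ⊆ Y` is a set of simple elements for `Y`: every element of `Y` is, in exactly one way,
a linear combination of elements of `P` with nonnegative integer coefficients. -/
structure IsSimpleSet {Q : Set V} (Y P : Set Q) : Prop where
  subset : P ⊆ Y
  existsUnique_sum : ∀ y ∈ Y, ∃! n : P →₀ ℕ, (n.sum fun p m => m • ((p : Q) : V)) = y

/-- The variety `X_{K²}`: functions `c : Q → ℂ` with `c (-α) = -c α` and
`c (α + β) (c α + c β) = c α c β + K²` whenever `α`, `β`, `α + β` lie in `Q`. -/
def bracketVariety (Q : Set V) (K : ℂ) : Set (Q → ℂ) :=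
  {c | (∀ α β : Q, (β : V) = -α → c β = -c α) ∧
    ∀ α β γ : Q, (γ : V) = α + β → c γ * (c α + c β) = c α * c β + K ^ 2}

/-- `RecursiveValue K s α x`: the recursive procedure started with the values `s` on the set `P`
yields the value `x` at `α`. A step passes from the values `x` at `α` and `y` at `β` to the value
`(x y + K²) / (x + y)` at `α + β`, and is allowed only if the denominator is nonzero. -/
inductive RecursiveValue {Q : Set V} (K : ℂ) {P : Set Q} (s : P → ℂ) : Q → ℂ → Prop
  | simple (p : P) : RecursiveValue K s p (s p)
  | step (α β γ : Q) (x y : ℂ) (hα : RecursiveValue K s α x) (hβ : RecursiveValue K s β y)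
      (hγ : (γ : V) = α + β) (hxy : x + y ≠ 0) :
      RecursiveValue K s γ ((x * y + K ^ 2) / (x + y))

/-- `c` is obtained recursively from its values on the set `P` of simple elements of `Y`:
no denominator occurring in the recursive procedure vanishes, and the procedure
reaches every element `α` of `Y`, yielding there the value `c α` and no other. -/
structure IsObtainedRecursively {Q : Set V} (K : ℂ) (Y P : Set Q) (c : Q → ℂ) : Prop where
  denom_ne_zero : ∀ (α β γ : Q) (x y : ℂ), RecursiveValue K (fun p : P => c p) α x →
    RecursiveValue K (fun p : P => c p) β y → (γ : V) = α + β → x + y ≠ 0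
  value_iff : ∀ α ∈ Y, ∀ x : ℂ, RecursiveValue K (fun p : P => c p) α x ↔ x = c α

/-- The ring of polynomial functions on a subset `X` of affine space. -/
abbrev CoordinateRing {σ : Type*} (X : Set (σ → ℂ)) : Type _ :=
  MvPolynomial σ ℂ ⧸ MvPolynomial.vanishingIdeal ℂ X

end Abstract

/-- `Q / B`: the image of `Q` without zero in the quotient by the linear span of `B`. -/
def quotientSet {V : Type*} [AddCommGroup V] [Module ℂ V] (Q B : Set V) :
    Set (V ⧸ Submodule.span ℂ B) :=
  (Submodule.mkQ (Submodule.span ℂ B) '' Q) \ {0}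

section LieAlg

variable {𝔤 : Type*} [LieRing 𝔤] [LieAlgebra ℂ 𝔤] [FiniteDimensional ℂ 𝔤] [LieAlgebra.IsSimple ℂ 𝔤]
  (𝔥 : LieSubalgebra ℂ 𝔤) [𝔥.IsCartanSubalgebra] (𝔩 : LieSubalgebra ℂ 𝔤)

/-- `𝔩` is a Levi subalgebra containing the Cartan subalgebra `𝔥`: for some set of simple roots
and some subset `Γ` of it, `𝔩` is generated by `𝔥` and the root spaces of `±α`, `α ∈ Γ`. -/
def IsLevi : Prop :=
  ∃ (Δ : (IsKilling.rootSystem 𝔥).Base) (Γ : Set 𝔥.root), Γ ⊆ Δ.support ∧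
    𝔩 = LieSubalgebra.lieSpan ℂ 𝔤
      ((𝔥 : Set 𝔤) ∪ ⋃ α ∈ Γ,
        ((rootSpace 𝔥 (α : Weight ℂ 𝔥 𝔤) : Set 𝔤) ∪ (rootSpace 𝔥 (-(α : Weight ℂ 𝔥 𝔤)) : Set 𝔤)))

/-- The set of roots of `𝔤` with respect to `𝔥`, in the dual of `𝔥`. -/
def roots : Set (Module.Dual ℂ 𝔥) := Set.range (IsKilling.rootSystem 𝔥).root

/-- The set of roots of `𝔩` with respect to `𝔥`. -/
def leviRoots : Set (Module.Dual ℂ 𝔥) :=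
  (IsKilling.rootSystem 𝔥).root '' {α | (rootSpace 𝔥 (α : Weight ℂ 𝔥 𝔤) : Set 𝔤) ⊆ 𝔩}

/-- The set of quasiroots. -/
def quasiroots : Set (Module.Dual ℂ 𝔥 ⧸ Submodule.span ℂ (leviRoots 𝔥 𝔩)) :=
  quotientSet (roots 𝔥) (leviRoots 𝔥 𝔩)

end LieAlg

end PhiBracket

end

/-!
Rescaled by the Cayley transform `w α = (c α + K) / (c α - K)`, a point of the variety is a family of
elements `w α ≠ 1` of the projective line, indexed by the quasiroots, with `w (-α) = (w α)⁻¹` and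
`w (α + β) = w α * w β` whenever the product makes sense: the defining relation is the addition
formula of the hyperbolic cotangent. The variety is thus an open part of a smooth toric variety, with
one chart, an open subset of an affine space, for each system of positive quasiroots `Y`.

*Combinatorics.* The only facts about quasiroots that are used are collected in `IsObtuseClosed`: they
form a finite symmetric set of nonzero vectors with a form, positive definite on the lattice they
generate, such that `α + β` is a quasiroot or zero as soon as `α` and `β` form an obtuse angle. For
roots this is classical. For quasiroots, averaging the canonical form over the Weyl group elements
acting trivially on the quotient reduces it to the case of roots
(`exists_isObtuseClosed_quotientSet`). The usual arguments then show that a semilinear set lies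
strictly on one side (`IsSemilinear.sum_ne_zero`), and that its indecomposable elements generate it,
are free (`IsSemilinear.multiset_eq`), form its unique set of simple elements, and are a basis of the
lattice of all quasiroots, so that their number does not depend on `Y`.

*Covering by charts.* Given a point `c`, the elements with `c α ≠ K` are closed under sums and those
with `c α = -K` absorb them; splitting the elements with `c α ≠ ± K` by a generic functional gives a
semilinear `Y` on which `c α ≠ K` (`exists_isSemilinear_forall_ne`). No denominator `c α + c β` can
then vanish for `α, β ∈ Y` with `α + β` a quasiroot, and induction along decompositions shows that the
recursion reaches all of `Y` (`isObtainedRecursively`).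

*Geometry of a chart.* On the chart of `Y`, the values `w p` at the indecomposables `p` are free
coordinates and every `w α`, `α ∈ Y`, is a monomial in them; the only condition is that no such
monomial is `1`. Hence the localization of the coordinate ring at `∏ (c α - K)` is a localization of a
polynomial ring away from one element (`exists_isLocalization_chartRing`). Polynomial rings over `ℂ`
are regular, and by the Nullstellensatz the charts cover the spectrum, which yields regularity and the
dimension. Each chart is the complement of a hypersurface in an affine space, hence connected, and all
charts share a point, `w = exp ∘ f` for a generic functional `f`.
-/

noncomputable section

namespace PhiBracket

/-! ### Semilinear sets and their indecomposable elements -/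

section Semilinear

variable {V : Type*} [AddCommGroup V]

/-- A finite symmetric set `Q` of nonzero elements of an additive group, together with a symmetric
biadditive form which is positive definite on the subgroup generated by `Q`, such that two elements
of `Q` forming an obtuse angle have their sum in `Q ∪ {0}`. Root systems have this property, and so
do their quotients. -/
structure IsObtuseClosed (Q : Set V) (B : V →+ V →+ ℝ) : Prop where
  finite : Q.Finite
  neg_mem : ∀ α ∈ Q, -α ∈ Q
  zero_notMem : (0 : V) ∉ Q
  symm : ∀ x y, B x y = B y x
  pos : ∀ x ∈ AddSubgroup.closure Q, x ≠ 0 → 0 < B x x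
  add_mem : ∀ α ∈ Q, ∀ β ∈ Q, B α β < 0 → α + β ≠ 0 → α + β ∈ Q

/-- An element of `Y` is indecomposable if it is not the sum of two elements of `Y`. -/
def indecomposables {Q : Set V} (Y : Set Q) : Set Q :=
  {b | b ∈ Y ∧ ∀ α ∈ Y, ∀ β ∈ Y, (b : V) ≠ α + β}

variable {Q : Set V} {B : V →+ V →+ ℝ} {Y : Set Q}

lemma multiset_sum_mem_closure (s : Multiset Q) :
    (s.map Subtype.val).sum ∈ AddSubgroup.closure Q := by
  refine AddSubgroup.multiset_sum_mem _ _ fun a ha => ?_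
  obtain ⟨q, -, rfl⟩ := Multiset.mem_map.1 ha
  exact AddSubgroup.subset_closure q.2

lemma apply_multiset_sum (x : V) (s : Multiset Q) :
    B x (s.map Subtype.val).sum = (s.map fun b : Q => B x b).sum := by
  rw [map_multiset_sum, Multiset.map_map]
  rfl

/-- A semilinear set lies strictly on one side: if a sum vanished, one of its terms would form an
obtuse angle with another, and the two could be replaced by their sum. -/
lemma IsSemilinear.sum_ne_zero (hQ : IsObtuseClosed Q B) (hY : IsSemilinear Y) (s : Multiset Q)
    (hs : s ≠ 0) (hsY : ∀ a ∈ s, a ∈ Y) : (s.map Subtype.val).sum ≠ 0 := by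
  induction h : Multiset.card s using Nat.strong_induction_on generalizing s with
  | _ n ih =>
  obtain ⟨a, ha⟩ := Multiset.exists_mem_of_ne_zero hs
  obtain ⟨m, rfl⟩ := Multiset.exists_cons_of_mem ha
  intro h0
  rw [Multiset.map_cons, Multiset.sum_cons] at h0
  have ha0 : (a : V) ≠ 0 := fun h => hQ.zero_notMem (h ▸ a.2)
  have hpos := hQ.pos a (AddSubgroup.subset_closure a.2) ha0
  have hm : B a (m.map Subtype.val).sum < 0 := by
    rw [eq_neg_of_add_eq_zero_right h0, map_neg]
    linarith
  obtain ⟨b, hb, hab⟩ : ∃ b ∈ m, B a (b : V) < 0 := by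
    by_contra! hcon
    rw [apply_multiset_sum] at hm
    refine hm.not_ge (Multiset.sum_nonneg fun x hx => ?_)
    obtain ⟨b, hb, rfl⟩ := Multiset.mem_map.1 hx
    exact hcon b hb
  obtain ⟨m, rfl⟩ := Multiset.exists_cons_of_mem hb
  have haY := hsY a (by simp)
  have hbY := hsY b (by simp)
  have hab0 : (a : V) + b ≠ 0 := fun h =>
    hY.neg_notMem a b haY (eq_neg_of_add_eq_zero_right h) hbY
  have hc := hQ.add_mem a a.2 b b.2 hab hab0
  refine ih (Multiset.card (⟨_, hc⟩ ::ₘ m)) (by rw [← h]; simp) (⟨_, hc⟩ ::ₘ m) (by simp)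
    (fun x hx => ?_) rfl ?_
  · rcases Multiset.mem_cons.1 hx with rfl | hx
    · exact hY.add_mem a b _ haY hbY rfl
    · exact hsY x (by simp [hx])
  · rw [← h0]
    simp [add_assoc]

/-- Induction on a semilinear set along decompositions into sums. -/
lemma IsSemilinear.induction (hQ : IsObtuseClosed Q B) (hY : IsSemilinear Y) {p : Q → Prop}
    (indec : ∀ b ∈ indecomposables Y, p b)
    (add : ∀ α ∈ Y, ∀ β ∈ Y, ∀ γ ∈ Y, (γ : V) = α + β → p α → p β → p γ) :
    ∀ α ∈ Y, p α := by
  have : Finite Q := hQ.finite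
  let r : Q → Q → Prop := fun a b =>
    ∃ m : Multiset Q, m ≠ 0 ∧ (∀ x ∈ m, x ∈ Y) ∧ (b : V) = a + (m.map Subtype.val).sum
  have : IsTrans Q r := ⟨by
    rintro a b c ⟨m, hm, hmY, hb⟩ ⟨m', -, hmY', hc⟩
    refine ⟨m + m', by simp [hm], fun x hx => ?_, by simp [hc, hb, add_assoc]⟩
    rcases Multiset.mem_add.1 hx with hx | hx
    exacts [hmY x hx, hmY' x hx]⟩
  have : Std.Irrefl r := ⟨by
    rintro a ⟨m, hm, hmY, ha⟩
    exact hY.sum_ne_zero hQ m hm hmY (by simpa using ha)⟩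
  have wf : WellFounded r := Finite.wellFounded_of_trans_of_irrefl r
  intro α
  induction α using wf.induction with
  | _ γ ih =>
  intro hγ
  by_cases hi : γ ∈ indecomposables Y
  · exact indec γ hi
  · simp only [indecomposables, Set.mem_ofPred_eq, hγ, true_and, not_forall, not_not] at hi
    obtain ⟨α, hα, β, hβ, h⟩ := hi
    exact add α hα β hβ γ hγ h (ih α ⟨{β}, by simp, by simpa, by simpa⟩ hα)
      (ih β ⟨{α}, by simp, by simpa, by simpa [add_comm] using h⟩ hβ)

lemma IsSemilinear.exists_multiset (hQ : IsObtuseClosed Q B) (hY : IsSemilinear Y) :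
    ∀ α ∈ Y, ∃ s : Multiset Q, (∀ b ∈ s, b ∈ indecomposables Y) ∧
      (s.map Subtype.val).sum = (α : V) := by
  refine hY.induction hQ (fun b hb => ⟨{b}, by simpa, by simp⟩) ?_
  rintro α - β - γ - h ⟨s, hs, hs'⟩ ⟨t, ht, ht'⟩
  refine ⟨s + t, fun b hb => ?_, by simp [hs', ht', h]⟩
  rcases Multiset.mem_add.1 hb with hb | hb
  exacts [hs b hb, ht b hb]

lemma IsSemilinear.apply_nonpos (hQ : IsObtuseClosed Q B) (hY : IsSemilinear Y) {a b : Q}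
    (ha : a ∈ indecomposables Y) (hb : b ∈ indecomposables Y) (hab : a ≠ b) :
    B (a : V) b ≤ 0 := by
  by_contra! hpos
  have hne : (a : V) + -b ≠ 0 := fun h =>
    hab (Subtype.ext (by rwa [add_neg_eq_zero] at h))
  have hmem := hQ.add_mem a a.2 (-b) (hQ.neg_mem b b.2) (by simpa) hne
  rcases hY.mem_or_neg_mem ⟨_, hmem⟩ with h | ⟨β, hβ, h⟩
  · exact ha.2 b hb.1 _ h (by simp)
  · exact hb.2 a ha.1 β hβ (by simp [h])

/-- Freeness of the indecomposables: after cancelling common terms of two equal sums, the remaining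
two sums pair nonpositively with each other, so they are both zero. -/
lemma IsSemilinear.multiset_eq (hQ : IsObtuseClosed Q B) (hY : IsSemilinear Y) {s t : Multiset Q}
    (hs : ∀ b ∈ s, b ∈ indecomposables Y) (ht : ∀ b ∈ t, b ∈ indecomposables Y)
    (h : (s.map Subtype.val).sum = (t.map Subtype.val).sum) : s = t := by
  classical
  have hs' := Multiset.sub_add_inter s t
  have ht' := Multiset.sub_add_inter t s
  rw [Multiset.inter_comm] at ht'
  have heq : ((s - t).map Subtype.val).sum = ((t - s).map Subtype.val).sum := by
    have h' := (congrArg (fun u => (u.map Subtype.val).sum) hs').trans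
      (h.trans (congrArg (fun u => (u.map Subtype.val).sum) ht').symm)
    simpa only [Multiset.map_add, Multiset.sum_add, add_left_inj] using h'
  have hle : B ((s - t).map Subtype.val).sum ((s - t).map Subtype.val).sum ≤ 0 := by
    nth_rewrite 2 [heq]
    rw [apply_multiset_sum]
    refine Multiset.sum_induction (· ≤ 0) _ (fun _ _ => add_nonpos) le_rfl fun x hx => ?_
    obtain ⟨b, hb, rfl⟩ := Multiset.mem_map.1 hx
    rw [hQ.symm, apply_multiset_sum]
    refine Multiset.sum_induction (· ≤ 0) _ (fun _ _ => add_nonpos) le_rfl fun x hx => ?_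
    obtain ⟨a, ha, rfl⟩ := Multiset.mem_map.1 hx
    refine hY.apply_nonpos hQ (ht b (Multiset.mem_of_le (Multiset.sub_le_self _ _) hb))
      (hs a (Multiset.mem_of_le (Multiset.sub_le_self _ _) ha)) ?_
    rintro rfl
    rw [Multiset.mem_sub] at ha hb
    exact lt_asymm ha hb
  have h0 : ((s - t).map Subtype.val).sum = 0 := by
    by_contra hne
    exact hle.not_gt (hQ.pos _ (multiset_sum_mem_closure _) hne)
  have hst : s - t = 0 := by
    by_contra hne
    exact hY.sum_ne_zero hQ _ hne
      (fun a ha => (hs a (Multiset.mem_of_le (Multiset.sub_le_self _ _) ha)).1) h0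
  have hts : t - s = 0 := by
    by_contra hne
    exact hY.sum_ne_zero hQ _ hne
      (fun a ha => (ht a (Multiset.mem_of_le (Multiset.sub_le_self _ _) ha)).1) (heq ▸ h0)
  exact (tsub_eq_zero_iff_le.1 hst).antisymm (tsub_eq_zero_iff_le.1 hts)

lemma finsupp_sum_eq_multiset_sum {P : Set Q} (n : P →₀ ℕ) :
    (n.sum fun p m => m • ((p : Q) : V)) =
      (((Finsupp.toMultiset n).map Subtype.val).map Subtype.val).sum := by
  induction n using Finsupp.induction_linear with
  | zero => simp
  | add f g hf hg =>
    rw [Finsupp.sum_add_index' (by simp) (by simp [add_smul]), hf, hg]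
    simp
  | single a b => simp [Multiset.map_nsmul, Multiset.sum_nsmul]

omit [AddCommGroup V] in
lemma mem_of_mem_map_toMultiset {P : Set Q} (n : P →₀ ℕ) :
    ∀ b ∈ (Finsupp.toMultiset n).map Subtype.val, b ∈ P := by
  intro b hb
  obtain ⟨c, -, rfl⟩ := Multiset.mem_map.1 hb
  exact c.2

lemma IsSemilinear.finsupp_eq (hQ : IsObtuseClosed Q B) (hY : IsSemilinear Y)
    {n m : indecomposables Y →₀ ℕ}
    (h : (n.sum fun p m => m • ((p : Q) : V)) = m.sum fun p m => m • ((p : Q) : V)) : n = m := by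
  classical
  rw [finsupp_sum_eq_multiset_sum, finsupp_sum_eq_multiset_sum] at h
  exact Multiset.toFinsupp.symm.injective (Multiset.map_injective Subtype.val_injective
    (hY.multiset_eq hQ (mem_of_mem_map_toMultiset n) (mem_of_mem_map_toMultiset m) h))

/-- The indecomposables of a semilinear set are a set of simple elements. -/
lemma IsSemilinear.isSimpleSet (hQ : IsObtuseClosed Q B) (hY : IsSemilinear Y) :
    IsSimpleSet Y (indecomposables Y) where
  subset _ h := h.1
  existsUnique_sum y hy := by
    classical
    obtain ⟨s, hs, hs'⟩ := hY.exists_multiset hQ y hy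
    lift s to Multiset (indecomposables Y) using hs
    have hsn : ((Multiset.toFinsupp s).sum fun p m => m • ((p : Q) : V)) = y := by
      rw [finsupp_sum_eq_multiset_sum, Multiset.toFinsupp_toMultiset, hs']
    exact ⟨Multiset.toFinsupp s, hsn, fun n hn => hY.finsupp_eq hQ (hn.trans hsn.symm)⟩

/-- The only set of simple elements of a semilinear set is the set of its indecomposables. -/
lemma IsSimpleSet.eq_indecomposables (hQ : IsObtuseClosed Q B) (hY : IsSemilinear Y) {P : Set Q}
    (hP : IsSimpleSet Y P) : P = indecomposables Y := by
  have hsub : P ⊆ indecomposables Y := by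
    intro p hp
    refine ⟨hP.subset hp, fun α hα β hβ h => ?_⟩
    obtain ⟨n, hn, -⟩ := hP.existsUnique_sum α hα
    obtain ⟨m, hm, -⟩ := hP.existsUnique_sum β hβ
    have h1 : n + m = Finsupp.single ⟨p, hp⟩ 1 := by
      refine (hP.existsUnique_sum p (hP.subset hp)).unique ?_ (by simp)
      rw [Finsupp.sum_add_index' (by simp) (by simp [add_smul])]
      exact (congrArg₂ (· + ·) hn hm).trans h.symm
    have hn0 : n ≠ 0 := by
      rintro rfl
      exact hQ.zero_notMem (by simpa [← hn] using α.2)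
    have hm0 : m ≠ 0 := by
      rintro rfl
      exact hQ.zero_notMem (by simpa [← hm] using β.2)
    have hdeg := congrArg Finsupp.degree h1
    rw [map_add, Finsupp.degree_single] at hdeg
    have := mt (Finsupp.degree_eq_zero_iff n).1 hn0
    have := mt (Finsupp.degree_eq_zero_iff m).1 hm0
    omega
  refine hsub.antisymm fun b hb => ?_
  obtain ⟨n, hn, -⟩ := hP.existsUnique_sum b hb.1
  have h := hY.multiset_eq hQ (s := {b}) (t := (Finsupp.toMultiset n).map Subtype.val)
    (by simpa) (fun a ha => hsub (mem_of_mem_map_toMultiset n a ha)) (by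
      rw [← finsupp_sum_eq_multiset_sum]
      simpa using hn.symm)
  exact mem_of_mem_map_toMultiset n b (h ▸ Multiset.mem_singleton_self b)

/-- The indecomposables are a basis of the lattice generated by `Q`, so their number does not
depend on the semilinear set. -/
lemma IsSemilinear.ncard_indecomposables (hQ : IsObtuseClosed Q B) (hY : IsSemilinear Y) :
    (indecomposables Y).ncard = Module.finrank ℤ (Submodule.span ℤ Q) := by
  have : Finite Q := hQ.finite
  have : Fintype (indecomposables Y) := Fintype.ofFinite _
  let v : indecomposables Y → V := fun b => (b : Q)
  have hspan : Submodule.span ℤ (Set.range v) = Submodule.span ℤ Q := by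
    refine le_antisymm (Submodule.span_mono ?_) (Submodule.span_le.2 ?_)
    · rintro _ ⟨b, rfl⟩
      exact b.1.2
    · have hmem : ∀ α ∈ Y, (α : V) ∈ Submodule.span ℤ (Set.range v) := by
        refine hY.induction hQ (fun b hb => Submodule.subset_span ⟨⟨b, hb⟩, rfl⟩) ?_
        intro α _ β _ γ _ h hα hβ
        rw [h]
        exact Submodule.add_mem _ hα hβ
      intro α hα
      rcases hY.mem_or_neg_mem ⟨α, hα⟩ with h | ⟨β, hβ, h⟩
      · exact hmem _ h
      · have := hmem _ hβ
        rw [h] at this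
        simpa using this
  have hli : LinearIndependent ℤ v := by
    rw [Fintype.linearIndependent_iff]
    intro g hg
    let p := Finsupp.equivFunOnFinite.symm fun b => (g b).toNat
    let q := Finsupp.equivFunOnFinite.symm fun b => (-g b).toNat
    have hpq : p = q := by
      refine hY.finsupp_eq hQ (sub_eq_zero.1 ?_)
      rw [Finsupp.sum_fintype _ _ (by simp), Finsupp.sum_fintype _ _ (by simp),
        ← Finset.sum_sub_distrib, ← hg]
      refine Finset.sum_congr rfl fun b _ => ?_
      change (g b).toNat • v b - (-g b).toNat • v b = g b • v b
      rw [← natCast_zsmul, ← natCast_zsmul, ← sub_smul]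
      congr 1
      omega
    intro b
    have : (g b).toNat = (-g b).toNat := DFunLike.congr_fun hpq b
    omega
  rw [← hspan, finrank_span_eq_card hli, ← Nat.card_coe_set_eq, Nat.card_eq_fintype_card]

end Semilinear

/-! ### Quotients of root systems -/

section RootQuotient

variable {ι M N : Type*} [AddCommGroup M] [Module ℂ M] [AddCommGroup N] [Module ℂ N]
  (P : RootPairing ι ℂ M N) (U : Submodule ℂ M)

/-- The elements of the Weyl group acting trivially on `M ⧸ U`. -/
def weylStabilizer : Subgroup P.weylGroup where
  carrier := {g | ∀ x : M, g • x - x ∈ U}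
  one_mem' x := by simp
  mul_mem' {g h} hg hh x := by
    have := U.add_mem (hg (h • x)) (hh x)
    rwa [sub_add_sub_cancel, ← mul_smul] at this
  inv_mem' {g} hg x := by
    have := U.neg_mem (hg (g⁻¹ • x))
    rwa [smul_inv_smul, neg_sub] at this

lemma ofIdx_mem_weylStabilizer {i : ι} (hi : P.root i ∈ U) :
    RootPairing.weylGroup.ofIdx P i ∈ weylStabilizer P U := by
  intro x
  rw [RootPairing.weylGroup.ofIdx_smul, RootPairing.Equiv.reflection_smul,
    RootPairing.reflection_apply]
  simpa using U.smul_mem _ hi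

instance [Finite ι] [P.IsRootSystem] : Finite P.weylGroup := by
  refine Finite.of_injective (fun g : P.weylGroup => fun i => P.weylGroupToPerm g i) ?_
  intro g h hgh
  refine Subtype.ext (RootPairing.Equiv.weightHom_injective P (LinearEquiv.toLinearMap_injective ?_))
  refine LinearMap.ext_on_range (v := P.root) RootPairing.IsRootSystem.span_root_eq_top fun i => ?_
  have := congrArg P.root (congrFun hgh i)
  simp only at this
  rwa [← RootPairing.weylGroup_apply_root, ← RootPairing.weylGroup_apply_root] at this

variable [Fintype ι] [P.IsRootSystem]

instance : Fintype (weylStabilizer P U) := Fintype.ofFinite _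

/-- The sum over the Weyl group elements acting trivially on `M ⧸ U`; up to a scalar, this is the
projection to the vectors fixed by these elements. -/
def weylSum : M →ₗ[ℂ] M := ∑ g : weylStabilizer P U, RootPairing.weylGroupRootRep P g

lemma weylSum_apply (x : M) :
    weylSum P U x = ∑ g : weylStabilizer P U, (g : P.weylGroup) • x := by
  simp [weylSum]
  rfl

lemma weylSum_smul (h : weylStabilizer P U) (x : M) :
    weylSum P U ((h : P.weylGroup) • x) = weylSum P U x := by
  simp only [weylSum_apply]
  refine Fintype.sum_equiv (Equiv.mulRight h) _ _ fun g => ?_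
  simp [mul_smul]

lemma smul_weylSum (h : weylStabilizer P U) (x : M) :
    (h : P.weylGroup) • weylSum P U x = weylSum P U x := by
  simp only [weylSum_apply, Finset.smul_sum]
  refine Fintype.sum_equiv (Equiv.mulLeft h) _ _ fun g => ?_
  simp [mul_smul]

lemma weylSum_root_eq_zero {i : ι} (hi : P.root i ∈ U) : weylSum P U (P.root i) = 0 := by
  have h := weylSum_smul P U ⟨_, ofIdx_mem_weylStabilizer P U hi⟩ (P.root i)
  rw [RootPairing.weylGroup.ofIdx_smul, RootPairing.Equiv.reflection_smul,
    RootPairing.reflection_apply_self, map_neg] at h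
  have : IsAddTorsionFree M := .of_isTorsionFree ℂ M
  exact self_eq_neg.1 h.symm

lemma weylSum_sub_mem (x : M) :
    weylSum P U x - Fintype.card (weylStabilizer P U) • x ∈ U := by
  rw [weylSum_apply, ← Finset.card_univ, ← Finset.sum_const, ← Finset.sum_sub_distrib]
  exact U.sum_mem fun g _ => g.2 x

variable [P.IsCrystallographic]

omit [P.IsRootSystem] in
lemma rootForm_smul_smul (g : P.weylGroup) (x y : M) :
    P.RootForm (g • x) (g • y) = P.RootForm x y :=
  RootPairing.InvariantForm.apply_weylGroup_smul P (B := P.toInvariantForm) g x y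

lemma rootForm_weylSum_weylSum (x y : M) :
    P.RootForm (weylSum P U x) (weylSum P U y) =
      Fintype.card (weylStabilizer P U) •
        ∑ g : weylStabilizer P U, P.RootForm x ((g : P.weylGroup) • y) := by
  have h1 (g : weylStabilizer P U) :
      P.RootForm (weylSum P U x) ((g : P.weylGroup) • y) = P.RootForm (weylSum P U x) y := by
    rw [← smul_weylSum P U g x, rootForm_smul_smul, smul_weylSum]
  rw [weylSum_apply P U y, map_sum]
  simp only [h1, Finset.sum_const, Finset.card_univ]
  congr 1
  rw [weylSum_apply, map_sum, LinearMap.sum_apply]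
  refine Fintype.sum_equiv (Equiv.inv _) _ _ fun g => ?_
  rw [← rootForm_smul_smul P (g : P.weylGroup) x]
  simp

omit [P.IsRootSystem] in
lemma rootForm_self_pos {x : M} (hx : x ∈ Submodule.span ℤ (Set.range P.root)) (h0 : x ≠ 0) :
    0 < (P.RootForm x x).re := by
  have h := P.posRootForm_posForm_pos_of_ne_zero ℤ (x := ⟨x, hx⟩) (by simpa using h0)
  have h2 := P.algebraMap_posRootForm_posForm ℤ ⟨x, hx⟩ ⟨x, hx⟩
  simp only at h2
  rw [← h2]
  simpa using h

omit [P.IsRootSystem] in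
lemma pairingIn_neg_of_rootForm_neg {i j : ι} (h : (P.RootForm (P.root i) (P.root j)).re < 0) :
    P.pairingIn ℤ i j < 0 := by
  have h1 := P.toInvariantForm.two_mul_apply_root_root i j
  rw [RootPairing.toInvariantForm_form, ← P.algebraMap_pairingIn ℤ] at h1
  have h2 := congrArg Complex.re h1
  have h3 := rootForm_self_pos P (Submodule.subset_span ⟨j, rfl⟩) (P.ne_zero j)
  simp at h2
  by_contra! hcon
  have : (0 : ℝ) ≤ P.pairingIn ℤ i j := by exact_mod_cast hcon
  nlinarith

omit [Fintype ι] [P.IsRootSystem] [P.IsCrystallographic] in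
lemma smul_mem_span_root (g : P.weylGroup) {x : M} (hx : x ∈ Submodule.span ℤ (Set.range P.root)) :
    g • x ∈ Submodule.span ℤ (Set.range P.root) := by
  induction hx using Submodule.span_induction with
  | mem x hx =>
    obtain ⟨i, rfl⟩ := hx
    rw [RootPairing.weylGroup_apply_root]
    exact Submodule.subset_span ⟨_, rfl⟩
  | zero => simp
  | add x y _ _ hx hy =>
    rw [smul_add]
    exact Submodule.add_mem _ hx hy
  | smul a x _ hx =>
    rw [smul_comm]
    exact Submodule.smul_mem _ _ hx

/-- The symmetric biadditive form induced on `M ⧸ U` by the canonical form of a root system. -/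
def quotientForm (hU : U ≤ (weylSum P U).ker) : M ⧸ U →+ M ⧸ U →+ ℝ :=
  AddMonoidHom.mk' (fun x => AddMonoidHom.mk'
    (fun y => (P.RootForm (U.liftQ (weylSum P U) hU x) (U.liftQ (weylSum P U) hU y)).re)
    (by simp)) (by intro x y; ext; simp)

omit [P.IsCrystallographic] in
lemma quotientForm_mk (hU : U ≤ (weylSum P U).ker) (x y : M) :
    quotientForm P U hU (U.mkQ x) (U.mkQ y) =
      (P.RootForm (weylSum P U x) (weylSum P U y)).re := rfl

/-- For any set `S` of roots, the image of a root system modulo the span of `S` is obtuse-closed: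
the form of two quotient roots is a positive multiple of the sum of the forms of `α` and `w β`,
with `w` running over the Weyl group elements acting trivially on the quotient; if it is negative,
then so is one term, and `α + w β` is a root. -/
theorem exists_isObtuseClosed_quotientSet {S : Set M} (hS : S ⊆ Set.range P.root) :
    ∃ B, IsObtuseClosed (quotientSet (Set.range P.root) S) B := by
  set U := Submodule.span ℂ S with hUdef
  have hU : U ≤ (weylSum P U).ker := by
    refine Submodule.span_le.2 fun x hx => ?_
    obtain ⟨i, rfl⟩ := hS hx
    exact weylSum_root_eq_zero P U (Submodule.subset_span hx)
  refine ⟨quotientForm P U hU, ?_, ?_, ?_, ?_, ?_, ?_⟩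
  · exact ((Set.finite_range _).image _).subset Set.sdiff_subset
  · rintro _ ⟨⟨_, ⟨i, rfl⟩, rfl⟩, h⟩
    refine ⟨⟨-P.root i, P.neg_root_mem i, map_neg _ _⟩, ?_⟩
    simpa using h
  · exact fun h => h.2 rfl
  · intro x y
    obtain ⟨x, rfl⟩ := U.mkQ_surjective x
    obtain ⟨y, rfl⟩ := U.mkQ_surjective y
    rw [quotientForm_mk, quotientForm_mk, ← P.rootForm_symmetric.eq]
    rfl
  · intro x hx
    obtain ⟨x, hxs, rfl⟩ : ∃ y ∈ Submodule.span ℤ (Set.range P.root), U.mkQ y = x := by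
      induction hx using AddSubgroup.closure_induction with
      | mem x hx =>
        obtain ⟨⟨y, hy, rfl⟩, -⟩ := hx
        exact ⟨y, Submodule.subset_span hy, rfl⟩
      | zero => exact ⟨0, zero_mem _, map_zero _⟩
      | add x y _ _ hx hy =>
        obtain ⟨x, hx, rfl⟩ := hx
        obtain ⟨y, hy, rfl⟩ := hy
        exact ⟨x + y, add_mem hx hy, map_add _ _ _⟩
      | neg x _ hx =>
        obtain ⟨x, hx, rfl⟩ := hx
        exact ⟨-x, neg_mem hx, map_neg _ _⟩
    intro hx0
    rw [quotientForm_mk]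
    refine rootForm_self_pos P ?_ fun h => hx0 ?_
    · rw [weylSum_apply]
      exact Submodule.sum_mem _ fun g _ => smul_mem_span_root P g hxs
    · have h1 := weylSum_sub_mem P U x
      rw [h, zero_sub, U.neg_mem_iff, ← Nat.cast_smul_eq_nsmul ℂ,
        U.smul_mem_iff (by simp [Fintype.card_ne_zero])] at h1
      simpa using h1
  · rintro _ ⟨⟨_, ⟨i, rfl⟩, rfl⟩, hi⟩ _ ⟨⟨_, ⟨j, rfl⟩, rfl⟩, hj⟩ hneg h0
    refine ⟨?_, h0⟩
    rw [quotientForm_mk, rootForm_weylSum_weylSum] at hneg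
    obtain ⟨g, hg⟩ : ∃ g : weylStabilizer P U,
        (P.RootForm (P.root i) ((g : P.weylGroup) • P.root j)).re < 0 := by
      by_contra! hcon
      refine hneg.not_ge ?_
      simp only [nsmul_eq_mul, Complex.mul_re, Complex.natCast_re, Complex.natCast_im, zero_mul,
        sub_zero, Complex.re_sum]
      exact mul_nonneg (Nat.cast_nonneg _) (Finset.sum_nonneg fun g _ => hcon g)
    have hmk : U.mkQ ((g : P.weylGroup) • P.root j) = U.mkQ (P.root j) := by
      exact (Submodule.Quotient.eq U).2 (g.2 (P.root j))
    rw [← hmk]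
    rw [← hmk] at h0
    rw [RootPairing.weylGroup_apply_root] at hg h0 ⊢
    rw [← map_add]
    refine ⟨_, P.root_add_root_mem_of_pairingIn_neg (pairingIn_neg_of_rootForm_neg P hg) ?_, rfl⟩
    intro h
    exact h0 (by rw [← map_add, h]; simp)

end RootQuotient

/-! ### Points of the variety and the recursion -/

section Points

variable {V : Type*} [AddCommGroup V] {Q : Set V} {K : ℂ} {c : Q → ℂ}

lemma eq_or_eq_of_apply_add_eq (hc : c ∈ bracketVariety Q K) {α β γ : Q}
    (h : (γ : V) = α + β) (hγ : c γ = K) : c α = K ∨ c β = K := by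
  have h1 := hc.2 α β γ h
  rw [hγ] at h1
  have h2 : (c α - K) * (c β - K) = 0 := by linear_combination -h1
  rcases mul_eq_zero.1 h2 with h | h
  exacts [.inl (sub_eq_zero.1 h), .inr (sub_eq_zero.1 h)]

lemma apply_add_eq_neg (hc : c ∈ bracketVariety Q K) {α β γ : Q}
    (h : (γ : V) = α + β) (hα : c α = -K) (hβ : c β ≠ K) : c γ = -K := by
  have h1 := hc.2 α β γ h
  rw [hα] at h1
  have h2 : (c γ + K) * (c β - K) = 0 := by linear_combination h1
  exact eq_neg_of_add_eq_zero_left ((mul_eq_zero.1 h2).resolve_right (sub_ne_zero.2 hβ))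

lemma add_ne_zero_of_ne (hc : c ∈ bracketVariety Q K) {α β γ : Q}
    (h : (γ : V) = α + β) (hα : c α ≠ K) (hβ : c β ≠ K) : c α + c β ≠ 0 := by
  intro h0
  have h1 := hc.2 α β γ h
  rw [h0, mul_zero] at h1
  have h2 : (c α - K) * (c β - K) = 0 := by linear_combination -h1 - K * h0
  rcases mul_eq_zero.1 h2 with h | h
  exacts [hα (sub_eq_zero.1 h), hβ (sub_eq_zero.1 h)]

/-- Every point of the variety lies in the chart of some semilinear set: `c α = K` never holds on
it. The elements with `c α ≠ K` are closed under sums, and those with `c α = -K` absorb them; the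
elements with `c α ≠ ± K` are distributed by the sign of a generic functional. -/
lemma exists_isSemilinear_forall_ne (hc : c ∈ bracketVariety Q K) (hK : K ≠ 0)
    (hneg : ∀ α ∈ Q, -α ∈ Q) (f : V →+ ℝ) (hf : ∀ α ∈ Q, f α ≠ 0) :
    ∃ Y : Set Q, IsSemilinear Y ∧ ∀ α ∈ Y, c α ≠ K := by
  have hKK : K ≠ -K := fun h => hK (self_eq_neg.1 h)
  refine ⟨{α | c α = -K ∨ (c α ≠ K ∧ 0 < f α)}, ⟨?_, ?_, ?_⟩, ?_⟩
  · rintro α β γ (hα | ⟨hα, hfα⟩) (hβ | ⟨hβ, hfβ⟩) h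
    · exact .inl (apply_add_eq_neg hc h hα (hβ ▸ hKK.symm))
    · exact .inl (apply_add_eq_neg hc h hα hβ)
    · exact .inl (apply_add_eq_neg hc (h.trans (add_comm _ _)) hβ hα)
    · refine .inr ⟨fun hγ => ?_, ?_⟩
      · rcases eq_or_eq_of_apply_add_eq hc h hγ with h | h
        exacts [hα h, hβ h]
      · rw [h, map_add]
        exact add_pos hfα hfβ
  · rintro α β hα h hβ
    have hcβ := hc.1 α β h
    have hfβ : f β = -f α := by rw [h, map_neg]
    rcases hα with hα | ⟨hα, hfα⟩ <;> rcases hβ with hβ | ⟨hβ, hfβ'⟩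
    · exact hKK (by rw [← hβ, hcβ, hα, neg_neg])
    · exact hβ (by rw [hcβ, hα, neg_neg])
    · exact hα (neg_inj.1 (hcβ.symm.trans hβ))
    · linarith
  · intro α
    have hcn := hc.1 α ⟨-α, hneg α α.2⟩ rfl
    by_cases h1 : c α = K
    · exact .inr ⟨⟨-α, hneg α α.2⟩, .inl (by rw [hcn, h1]), rfl⟩
    by_cases h2 : c α = -K
    · exact .inl (.inl h2)
    rcases (hf α α.2).lt_or_gt with h | h
    · refine .inr ⟨⟨-α, hneg α α.2⟩, .inr ⟨?_, by simpa using h⟩, rfl⟩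
      rw [hcn]
      exact fun h => h2 (by rw [← h, neg_neg])
    · exact .inl (.inr ⟨h1, h⟩)
  · rintro α (hα | hα)
    · exact hα ▸ hKK.symm
    · exact hα.1

lemma RecursiveValue.mem_and_eq {Y P : Set Q} (hc : c ∈ bracketVariety Q K)
    (hY : IsSemilinear Y) (hP : P ⊆ Y) {α : Q} {x : ℂ}
    (h : RecursiveValue K (fun p : P => c p) α x) : α ∈ Y ∧ x = c α := by
  induction h with
  | simple p => exact ⟨hP p.2, rfl⟩
  | step α β γ x y _ _ hγ hxy hα hβ =>
    obtain ⟨hα, rfl⟩ := hα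
    obtain ⟨hβ, rfl⟩ := hβ
    exact ⟨hY.add_mem α β γ hα hβ hγ, (eq_div_of_mul_eq hxy (hc.2 α β γ hγ)).symm⟩

lemma isObtainedRecursively {B : V →+ V →+ ℝ} (hQ : IsObtuseClosed Q B) {Y : Set Q}
    (hc : c ∈ bracketVariety Q K) (hY : IsSemilinear Y) (hcY : ∀ α ∈ Y, c α ≠ K) :
    IsObtainedRecursively K Y (indecomposables Y) c := by
  have hsub : indecomposables Y ⊆ Y := fun _ h => h.1
  refine ⟨fun α β γ x y hx hy h => ?_, fun α hα x => ⟨fun h => (h.mem_and_eq hc hY hsub).2, ?_⟩⟩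
  · obtain ⟨hα, rfl⟩ := hx.mem_and_eq hc hY hsub
    obtain ⟨hβ, rfl⟩ := hy.mem_and_eq hc hY hsub
    exact add_ne_zero_of_ne hc h (hcY α hα) (hcY β hβ)
  · rintro rfl
    revert α
    refine hY.induction hQ (fun b hb => RecursiveValue.simple (⟨b, hb⟩ : indecomposables Y)) ?_
    intro α hα β hβ γ _ h hrα hrβ
    have hne := add_ne_zero_of_ne hc h (hcY α hα) (hcY β hβ)
    rw [eq_div_of_mul_eq hne (hc.2 α β γ h)]
    exact RecursiveValue.step α β γ _ _ hrα hrβ h hne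

end Points

/-! ### Coordinates on a chart -/

section Chart

variable {V : Type*} [AddCommGroup V] {Q : Set V} {B : V →+ V →+ ℝ} {Y : Set Q} {K : ℂ}

/-- The exponents of an element of `Y` as a combination of indecomposables; zero outside `Y`. -/
def exponents (Y : Set Q) (α : Q) : indecomposables Y →₀ ℕ :=
  open scoped Classical in
  if h : ∃ n : indecomposables Y →₀ ℕ, (n.sum fun p m => m • ((p : Q) : V)) = α then h.choose else 0

lemma exponents_sum (hQ : IsObtuseClosed Q B) (hY : IsSemilinear Y) {α : Q} (hα : α ∈ Y) :
    ((exponents Y α).sum fun p m => m • ((p : Q) : V)) = α := by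
  have h := ((hY.isSimpleSet hQ).existsUnique_sum α hα).exists
  rw [exponents, dif_pos h]
  exact h.choose_spec

lemma exponents_add (hQ : IsObtuseClosed Q B) (hY : IsSemilinear Y) {α β γ : Q} (hα : α ∈ Y)
    (hβ : β ∈ Y) (hγ : γ ∈ Y) (h : (γ : V) = α + β) :
    exponents Y γ = exponents Y α + exponents Y β := by
  refine hY.finsupp_eq hQ ?_
  rw [Finsupp.sum_add_index' (by simp) (by simp [add_smul]), exponents_sum hQ hY hα,
    exponents_sum hQ hY hβ, exponents_sum hQ hY hγ, h]

lemma exponents_indecomposable (hQ : IsObtuseClosed Q B) (hY : IsSemilinear Y)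
    (p : indecomposables Y) : exponents Y p = Finsupp.single p 1 := by
  refine hY.finsupp_eq hQ ?_
  rw [exponents_sum hQ hY p.2.1]
  simp

/-- The monomial in the variables attached to the indecomposables, with the exponents of `α`. -/
def chartMonomial (Y : Set Q) (z : indecomposables Y → ℂ) (α : Q) : ℂ :=
  (exponents Y α).prod fun p m => z p ^ m

lemma chartMonomial_add (hQ : IsObtuseClosed Q B) (hY : IsSemilinear Y)
    (z : indecomposables Y → ℂ) {α β γ : Q} (hα : α ∈ Y)
    (hβ : β ∈ Y) (hγ : γ ∈ Y) (h : (γ : V) = α + β) :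
    chartMonomial Y z γ = chartMonomial Y z α * chartMonomial Y z β := by
  rw [chartMonomial, exponents_add hQ hY hα hβ hγ h,
    Finsupp.prod_add_index' (by simp) (by simp [pow_add])]
  rfl

lemma chartMonomial_indecomposable (hQ : IsObtuseClosed Q B) (hY : IsSemilinear Y)
    (z : indecomposables Y → ℂ) (p : indecomposables Y) : chartMonomial Y z p = z p := by
  simp [chartMonomial, exponents_indecomposable hQ hY]

/-- The point of the variety with coordinates `z`: its value `c α` at `α ∈ Y` is determined by
`(c α + K) / (c α - K)` being the monomial of `α` in `z`. For a semilinear `Y` the last case does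
not occur. -/
def chartPoint (Y : Set Q) (K : ℂ) (z : indecomposables Y → ℂ) (α : Q) : ℂ :=
  open scoped Classical in
  if α ∈ Y then K * ((chartMonomial Y z α + 1) / (chartMonomial Y z α - 1))
  else if h : -(α : V) ∈ Q then
    -(K * ((chartMonomial Y z ⟨-α, h⟩ + 1) / (chartMonomial Y z ⟨-α, h⟩ - 1)))
  else 0

/-- The coordinates, in the affine space over the indecomposables, of the points of the chart. -/
def chartDomain (Y : Set Q) : Set (indecomposables Y → ℂ) :=
  {z | ∀ α ∈ Y, chartMonomial Y z α ≠ 1}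

variable {z : indecomposables Y → ℂ}

lemma chartPoint_of_mem {α : Q} (hα : α ∈ Y) :
    chartPoint Y K z α = K * ((chartMonomial Y z α + 1) / (chartMonomial Y z α - 1)) :=
  if_pos hα

lemma chartPoint_neg (hY : IsSemilinear Y) {α β : Q} (h : (β : V) = -α) :
    chartPoint Y K z β = -chartPoint Y K z α := by
  have key : ∀ α β : Q, α ∈ Y → (β : V) = -α → chartPoint Y K z β = -chartPoint Y K z α := by
    intro α β hα h
    have hβ := hY.neg_notMem α β hα h
    have h' : -(β : V) = α := by rw [h, neg_neg]
    rw [chartPoint_of_mem hα, chartPoint, if_neg hβ, dif_pos (h' ▸ α.2)]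
    simp only [h']
  rcases hY.mem_or_neg_mem α with hα | ⟨β', hβ, h'⟩
  · exact key α β hα h
  · obtain rfl : β' = β := Subtype.ext (h'.trans h.symm)
    rw [key β' α hβ (by rw [h, neg_neg]), neg_neg]

/-- With all signs brought to one side, the defining relation is symmetric in three elements with
sum zero, and in an overall change of sign; so it need only be checked for two elements of `Y` whose
sum is in `Y`. -/
lemma chartPoint_mem (hQ : IsObtuseClosed Q B) (hY : IsSemilinear Y) (hz : z ∈ chartDomain Y) :
    chartPoint Y K z ∈ bracketVariety Q K := by
  set c := chartPoint Y K z with hc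
  have hneg : ∀ α β : Q, (β : V) = -α → c β = -c α := fun α β h => chartPoint_neg hY h
  have hdir : ∀ α ∈ Y, ∀ β ∈ Y, ∀ γ ∈ Y, (γ : V) = α + β →
      c γ * (c α + c β) = c α * c β + K ^ 2 := by
    intro α hα β hβ γ hγ h
    have h1 := sub_ne_zero.2 (hz α hα)
    have h2 := sub_ne_zero.2 (hz β hβ)
    have h3 := sub_ne_zero.2 (hz γ hγ)
    rw [hc, chartPoint_of_mem hα, chartPoint_of_mem hβ, chartPoint_of_mem hγ]
    rw [chartMonomial_add hQ hY z hα hβ hγ h] at h3 ⊢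
    field_simp
    ring
  have htwo : ∀ α ∈ Y, ∀ β ∈ Y, ∀ δ : Q, (α : V) + β + δ = 0 →
      c α * c β + c β * c δ + c δ * c α + K ^ 2 = 0 := by
    intro α hα β hβ δ h
    have hγ : (α : V) + β ∈ Q := by
      rw [eq_neg_of_add_eq_zero_left h]
      exact hQ.neg_mem _ δ.2
    have h1 := hdir α hα β hβ ⟨_, hγ⟩ (hY.add_mem α β _ hα hβ rfl) rfl
    have h2 := hneg ⟨_, hγ⟩ δ (eq_neg_of_add_eq_zero_right h)
    linear_combination (-1 : ℂ) * h1 + (c α + c β) * h2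
  have htwo' : ∀ α β δ : Q, ∀ α' ∈ Y, ∀ β' ∈ Y, (α' : V) = -α → (β' : V) = -β →
      (α : V) + β + δ = 0 → c α * c β + c β * c δ + c δ * c α + K ^ 2 = 0 := by
    intro α β δ α' hα β' hβ hα' hβ' h
    have h1 := htwo α' hα β' hβ ⟨-δ, hQ.neg_mem δ δ.2⟩
      (by rw [hα', hβ', ← neg_add, ← neg_add, h, neg_zero])
    rw [hneg α α' hα', hneg β β' hβ', hneg δ ⟨-δ, _⟩ rfl] at h1
    linear_combination h1
  have hthree : ∀ α β δ : Q, (α : V) + β + δ = 0 →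
      c α * c β + c β * c δ + c δ * c α + K ^ 2 = 0 := by
    intro α β δ h
    rcases hY.mem_or_neg_mem α with hα | ⟨α', hα, hα'⟩ <;>
    rcases hY.mem_or_neg_mem β with hβ | ⟨β', hβ, hβ'⟩
    · exact htwo α hα β hβ δ h
    · rcases hY.mem_or_neg_mem δ with hδ | ⟨δ', hδ, hδ'⟩
      · linear_combination htwo α hα δ hδ β (by rw [← h]; abel)
      · linear_combination htwo' β δ α β' hβ δ' hδ hβ' hδ' (by rw [← h]; abel)
    · rcases hY.mem_or_neg_mem δ with hδ | ⟨δ', hδ, hδ'⟩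
      · linear_combination htwo β hβ δ hδ α (by rw [← h]; abel)
      · linear_combination htwo' α δ β α' hα δ' hδ hα' hδ' (by rw [← h]; abel)
    · exact htwo' α β δ α' hα β' hβ hα' hβ' h
  refine ⟨hneg, fun α β γ h => ?_⟩
  have h1 := hthree α β ⟨-γ, hQ.neg_mem γ γ.2⟩ (by simp [h])
  rw [hneg γ ⟨-γ, hQ.neg_mem γ γ.2⟩ rfl] at h1
  linear_combination (-1 : ℂ) * h1

lemma chartPoint_ne (hK : K ≠ 0) (hz : z ∈ chartDomain Y) {α : Q} (hα : α ∈ Y) :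
    chartPoint Y K z α ≠ K := by
  have h1 := sub_ne_zero.2 (hz α hα)
  rw [chartPoint_of_mem hα]
  intro h
  field_simp at h
  have h2 : (2 : ℂ) = 0 := by linear_combination h
  norm_num at h2

/-- The point `c` of the variety has coordinates `(c p + K) / (c p - K)` in the chart of `Y`. -/
lemma chartMonomial_eq (hQ : IsObtuseClosed Q B) (hY : IsSemilinear Y) {c : Q → ℂ}
    (hc : c ∈ bracketVariety Q K) (hcY : ∀ α ∈ Y, c α ≠ K) :
    ∀ α ∈ Y, chartMonomial Y (fun p => (c p + K) / (c p - K)) α = (c α + K) / (c α - K) := by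
  refine hY.induction hQ (fun b hb => chartMonomial_indecomposable hQ hY _ ⟨b, hb⟩) ?_
  intro α hα β hβ γ hγ h hα' hβ'
  have h1 := sub_ne_zero.2 (hcY α hα)
  have h2 := sub_ne_zero.2 (hcY β hβ)
  have h3 := sub_ne_zero.2 (hcY γ hγ)
  rw [chartMonomial_add hQ hY _ hα hβ hγ h, hα', hβ', div_mul_div_comm, div_eq_div_iff
    (mul_ne_zero h1 h2) h3]
  linear_combination (2 * K) * hc.2 α β γ h

lemma exists_chartPoint_eq (hQ : IsObtuseClosed Q B) (hY : IsSemilinear Y) (hK : K ≠ 0) {c : Q → ℂ}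
    (hc : c ∈ bracketVariety Q K) (hcY : ∀ α ∈ Y, c α ≠ K) :
    ∃ z ∈ chartDomain Y, chartPoint Y K z = c := by
  have hm := chartMonomial_eq hQ hY hc hcY
  have hval : ∀ α ∈ Y, chartPoint Y K (fun p => (c p + K) / (c p - K)) α = c α := by
    intro α hα
    have h1 := sub_ne_zero.2 (hcY α hα)
    rw [chartPoint_of_mem hα, hm α hα, div_add_one h1, div_sub_one h1, div_div_div_cancel_right₀ h1]
    have h2 : c α + K - (c α - K) ≠ 0 := by
      rw [add_sub_sub_cancel]
      exact fun h => hK (add_self_eq_zero.1 h)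
    field_simp
    ring
  refine ⟨fun p => (c p + K) / (c p - K), fun α hα => ?_, funext fun α => ?_⟩
  · rw [hm α hα, Ne, div_eq_one_iff_eq (sub_ne_zero.2 (hcY α hα))]
    intro h
    exact hK (add_self_eq_zero.1 (by linear_combination h))
  · rcases hY.mem_or_neg_mem α with hα | ⟨β, hβ, h⟩
    · exact hval α hα
    · have h' : (α : V) = -β := by rw [h, neg_neg]
      rw [chartPoint_neg hY h', hval β hβ, hc.1 β α h']

end Chart

/-! ### Regularity and dimension from charts -/

section CommAlg

variable {R A T : Type*} [CommRing R] [CommRing A] [CommRing T] [Algebra R T] [Algebra A T]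

lemma isRegularLocalRing_localization_iff (M : Submonoid A) [IsLocalization M T]
    (q : Ideal T) [q.IsPrime] :
    IsRegularLocalRing (Localization.AtPrime q) ↔
      IsRegularLocalRing (Localization.AtPrime (q.comap (algebraMap A T))) := by
  have := IsLocalization.isLocalization_isLocalization_atPrime_isLocalization M
    (Localization.AtPrime q) q
  let e := (IsLocalization.algEquiv (q.comap (algebraMap A T)).primeCompl
    (Localization.AtPrime q) (Localization.AtPrime (q.comap (algebraMap A T)))).toRingEquiv
  exact ⟨fun _ => .of_ringEquiv e, fun _ => .of_ringEquiv e.symm⟩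

lemma ringKrullDim_le_of_isLocalization (M : Submonoid A) [IsLocalization M T] :
    ringKrullDim T ≤ ringKrullDim A := by
  refine (ringKrullDim_le_iff_height_le _).2 fun p hp => ?_
  rw [← IsLocalization.height_under M p]
  exact Ideal.height_le_ringKrullDim_of_ne_top Ideal.IsPrime.ne_top'

/-- Regularity at a prime may be tested on any open subset isomorphic to an open subset of the
spectrum of a regular ring. -/
lemma isRegularLocalRing_atPrime_of_chart {f : R} {g : A} [IsLocalization.Away f T]
    [IsLocalization.Away g T] [IsRegularRing A] (p : Ideal R) [p.IsPrime] (hf : f ∉ p) :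
    IsRegularLocalRing (Localization.AtPrime p) := by
  have hd : Disjoint (Submonoid.powers f : Set R) p :=
    (Ideal.disjoint_powers_iff_notMem_of_isPrime f).2 hf
  have hq := IsLocalization.isPrime_of_isPrime_disjoint (.powers f) T p ‹_› hd
  have h1 := isRegularLocalRing_localization_iff (.powers f) (p.map (algebraMap R T))
  have h2 := isRegularLocalRing_localization_iff (.powers g) (p.map (algebraMap R T))
  have h3 := IsLocalization.under_map_of_isPrime_disjoint (.powers f) T ‹_› hd
  rw [Ideal.under_def] at h3
  rw! [h3] at h1
  exact h1.1 (h2.2 inferInstance)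

lemma height_le_of_chart {f : R} {g : A} [IsLocalization.Away f T]
    [IsLocalization.Away g T] (p : Ideal R) [p.IsPrime] (hf : f ∉ p) :
    p.height ≤ ringKrullDim A := by
  have hd : Disjoint (Submonoid.powers f : Set R) p :=
    (Ideal.disjoint_powers_iff_notMem_of_isPrime f).2 hf
  have hq := IsLocalization.isPrime_of_isPrime_disjoint (.powers f) T p ‹_› hd
  rw [← IsLocalization.height_map_of_disjoint (S := T) (.powers f) p hd]
  exact (Ideal.height_le_ringKrullDim_of_ne_top hq.ne_top).trans
    (ringKrullDim_le_of_isLocalization (.powers g))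

lemma height_le_ringKrullDim_of_chart {f : R} {g : A} [IsLocalization.Away f T]
    [IsLocalization.Away g T] (m : Ideal A) [m.IsPrime] (hg : g ∉ m) :
    m.height ≤ ringKrullDim R := by
  have hd : Disjoint (Submonoid.powers g : Set A) m :=
    (Ideal.disjoint_powers_iff_notMem_of_isPrime g).2 hg
  have hq := IsLocalization.isPrime_of_isPrime_disjoint (.powers g) T m ‹_› hd
  rw [← IsLocalization.height_map_of_disjoint (S := T) (.powers g) m hd]
  exact (Ideal.height_le_ringKrullDim_of_ne_top hq.ne_top).trans
    (ringKrullDim_le_of_isLocalization (.powers f))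

/-- The maximal ideal of every point of affine space has the height of the dimension: some maximal
ideal does, it is the ideal of a point, and translations act transitively on the points. -/
lemma exists_isMaximal_height_eq {σ : Type*} [Finite σ] (z : σ → ℂ) :
    ∃ m : Ideal (MvPolynomial σ ℂ), m.IsMaximal ∧ (∀ F ∈ m, MvPolynomial.eval z F = 0) ∧
      m.height = (Nat.card σ : WithBot ℕ∞) := by
  have : FiniteRingKrullDim (MvPolynomial σ ℂ) := by
    rw [finiteRingKrullDim_iff_ne_bot_and_top]
    rw [MvPolynomial.ringKrullDim_of_isNoetherianRing, ringKrullDim_eq_zero_of_field, zero_add]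
    exact ⟨WithBot.coe_ne_bot, fun h => ENat.natCast_ne_top _ (WithBot.coe_injective h)⟩
  obtain ⟨m, hm, hh⟩ := Ideal.exists_isMaximal_height (R := MvPolynomial σ ℂ)
  obtain ⟨w, rfl⟩ := MvPolynomial.isMaximal_iff_eq_vanishingIdeal_singleton.1 hm
  let τ (v : σ → ℂ) : MvPolynomial σ ℂ →ₐ[ℂ] MvPolynomial σ ℂ :=
    MvPolynomial.aeval fun i => MvPolynomial.X i + MvPolynomial.C (v i)
  -- the substitution `x ↦ x + (z - w)`, whose value at `w` is the value at `z`
  let e : MvPolynomial σ ℂ ≃ₐ[ℂ] MvPolynomial σ ℂ := AlgEquiv.ofAlgHom (τ (z - w)) (τ (w - z))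
    (MvPolynomial.algHom_ext fun i => by simp [τ]; abel)
    (MvPolynomial.algHom_ext fun i => by simp [τ]; abel)
  refine ⟨(MvPolynomial.vanishingIdeal ℂ {w}).comap e.toRingEquiv, ?_, ?_, ?_⟩
  · exact Ideal.comap_isMaximal_of_equiv e.toRingEquiv
  · intro F hF
    have h := (MvPolynomial.mem_vanishingIdeal_singleton_iff _ _).1 (Ideal.mem_comap.1 hF)
    have h2 : (MvPolynomial.aeval w).comp (τ (z - w)) = MvPolynomial.aeval z := by
      ext i; simp [τ]
    rw [← MvPolynomial.coe_aeval_eq_eval, ← h, ← h2]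
    rfl
  · rw [RingEquiv.height_comap, hh]
    simp

end CommAlg

/-! ### The coordinate ring of a chart -/

section ChartRing

open MvPolynomial

variable {V : Type*} [AddCommGroup V] {Q : Set V} {B : V →+ V →+ ℝ} {Y : Set Q} {K : ℂ}

/-- The monomial of `α` in the coordinates of the chart of `Y`, minus one. -/
def chartPoly (Y : Set Q) (α : Q) : MvPolynomial (indecomposables Y) ℂ :=
  monomial (exponents Y α) 1 - 1

lemma eval_chartPoly (z : indecomposables Y → ℂ) (α : Q) :
    eval z (chartPoly Y α) = chartMonomial Y z α - 1 := by
  simp [chartPoly, chartMonomial, eval_monomial]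

variable [Finite Q]

/-- The equation of the complement of the chart of `Y` in the affine space over the
indecomposables. -/
def chartDenom (Y : Set Q) : MvPolynomial (indecomposables Y) ℂ :=
  ∏ α ∈ Y.toFinite.toFinset, chartPoly Y α

lemma eval_chartDenom_ne_zero {z : indecomposables Y → ℂ} :
    eval z (chartDenom Y) ≠ 0 ↔ z ∈ chartDomain Y := by
  simp [chartDenom, Finset.prod_ne_zero_iff, eval_chartPoly, sub_eq_zero, chartDomain]

/-- The equation of the complement of the chart of `Y` in the variety. -/
def chartEquation (Y : Set Q) (K : ℂ) : MvPolynomial Q ℂ :=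
  ∏ α ∈ Y.toFinite.toFinset, (X α - C K)

omit [AddCommGroup V] in
lemma eval_chartEquation_ne_zero {c : Q → ℂ} :
    eval c (chartEquation Y K) ≠ 0 ↔ ∀ α ∈ Y, c α ≠ K := by
  simp [chartEquation, Finset.prod_ne_zero_iff, sub_eq_zero]

/-- The coordinate ring of the chart of `Y`. -/
abbrev ChartRing (Y : Set Q) := Localization.Away (chartDenom Y)

lemma isUnit_chartPoly {α : Q} (hα : α ∈ Y) :
    IsUnit (algebraMap _ (ChartRing Y) (chartPoly Y α)) := by
  have h := IsLocalization.Away.algebraMap_isUnit (S := ChartRing Y) (chartDenom Y)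
  exact isUnit_of_dvd_unit (map_dvd _ (Finset.dvd_prod_of_mem _ (by simpa))) h

/-- The coordinate functions of the variety on the chart of `Y`, given by the formula of `chartPoint`;
the elements inverted here are units of the chart ring. -/
def chartCoord (Y : Set Q) (K : ℂ) (α : Q) : ChartRing Y :=
  open scoped Classical in
  let u (α : Q) : ChartRing Y := algebraMap _ _ (C K * (chartPoly Y α + 2)) *
    Ring.inverse (algebraMap _ _ (chartPoly Y α))
  if α ∈ Y then u α else if h : -(α : V) ∈ Q then -u ⟨-α, h⟩ else 0

lemma chartCoord_mul {α : Q} (hα : α ∈ Y) :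
    chartCoord Y K α * algebraMap _ _ (chartPoly Y α) =
      algebraMap _ _ (C K * (chartPoly Y α + 2)) := by
  rw [chartCoord, if_pos hα, mul_assoc, Ring.inverse_mul_cancel _ (isUnit_chartPoly hα), mul_one]

/-- Evaluation of functions on the chart at a point. -/
def chartEval {z : indecomposables Y → ℂ} (hz : z ∈ chartDomain Y) : ChartRing Y →+* ℂ :=
  IsLocalization.Away.lift (chartDenom Y) (g := eval z)
    (isUnit_iff_ne_zero.2 (eval_chartDenom_ne_zero.2 hz))

lemma chartEval_algebraMap {z : indecomposables Y → ℂ} (hz : z ∈ chartDomain Y)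
    (F : MvPolynomial (indecomposables Y) ℂ) :
    chartEval hz (algebraMap _ _ F) = eval z F :=
  IsLocalization.Away.lift_eq _ _ _

lemma eq_zero_of_chartEval (t : ChartRing Y)
    (h : ∀ z (hz : z ∈ chartDomain Y), chartEval hz t = 0) : t = 0 := by
  obtain ⟨n, a, ha⟩ := IsLocalization.Away.surj (chartDenom Y) t
  have hu := IsLocalization.Away.algebraMap_isUnit (S := ChartRing Y) (chartDenom Y)
  have h0 : a * chartDenom Y = 0 := by
    refine MvPolynomial.funext fun z => ?_
    by_cases hz : z ∈ chartDomain Y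
    · have := congrArg (chartEval hz) ha
      rw [map_mul, h z hz, zero_mul, chartEval_algebraMap] at this
      simp [← this]
    · simp [not_not.1 (mt eval_chartDenom_ne_zero.1 hz)]
  have h1 : algebraMap _ (ChartRing Y) a = 0 := by
    have := congrArg (algebraMap _ (ChartRing Y)) h0
    rw [map_mul, map_zero] at this
    exact (hu.mul_left_eq_zero).1 this
  rw [h1] at ha
  exact ((hu.pow n).mul_left_eq_zero).1 ha

lemma chartEval_chartCoord {z : indecomposables Y → ℂ} (hz : z ∈ chartDomain Y)
    (hY : IsSemilinear Y) (α : Q) : chartEval hz (chartCoord Y K α) = chartPoint Y K z α := by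
  have key : ∀ α ∈ Y, chartEval hz (chartCoord Y K α) = chartPoint Y K z α := by
    intro α hα
    have h := congrArg (chartEval hz) (chartCoord_mul (K := K) hα)
    rw [map_mul, chartEval_algebraMap, chartEval_algebraMap] at h
    simp only [map_mul, map_add, eval_C, eval_chartPoly, map_ofNat] at h
    have h1 := sub_ne_zero.2 (hz α hα)
    rw [chartPoint_of_mem hα, ← mul_div_assoc, eq_div_iff h1, h]
    ring
  rcases hY.mem_or_neg_mem α with hα | ⟨β, hβ, h⟩
  · exact key α hα
  · have h' : (α : V) = -β := by rw [h, neg_neg]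
    have hα : α ∉ Y := hY.neg_notMem β α hβ h'
    have hk := key β hβ
    rw [chartPoint_neg hY h', ← hk, chartCoord, if_neg hα, dif_pos (h ▸ β.2), chartCoord,
      if_pos hβ, map_neg]
    simp only [← h]

lemma chartEval_aeval {z : indecomposables Y → ℂ} (hz : z ∈ chartDomain Y)
    (hY : IsSemilinear Y) (F : MvPolynomial Q ℂ) :
    chartEval hz (aeval (chartCoord Y K) F) = eval (chartPoint Y K z) F := by
  have : (chartEval hz).comp (aeval (chartCoord Y K)).toRingHom = eval (chartPoint Y K z) := by
    refine MvPolynomial.ringHom_ext (fun r => ?_) fun α => ?_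
    · simp only [AlgHom.toRingHom_eq_coe, RingHom.comp_apply, RingHom.coe_coe, algHom_C, eval_C]
      rw [IsScalarTower.algebraMap_apply ℂ (MvPolynomial (indecomposables Y) ℂ) (ChartRing Y),
        chartEval_algebraMap, MvPolynomial.algebraMap_eq, eval_C]
    · simp [chartEval_chartCoord hz hY]
  exact RingHom.congr_fun this F

/-- The chart of `Y`, where no coordinate `c α` with `α ∈ Y` equals `K`, is isomorphic to the open
subset `chartDomain Y` of the affine space over the indecomposables. -/
theorem exists_isLocalization_chartRing (hQ : IsObtuseClosed Q B) (hY : IsSemilinear Y)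
    (hK : K ≠ 0) :
    ∃ φ : CoordinateRing (bracketVariety Q K) →+* ChartRing Y,
      letI := φ.toAlgebra
      IsLocalization.Away (Ideal.Quotient.mk (vanishingIdeal ℂ (bracketVariety Q K))
        (chartEquation Y K)) (ChartRing Y) := by
  let ψ : MvPolynomial Q ℂ →ₐ[ℂ] ChartRing Y := aeval (chartCoord Y K)
  have hψ : ∀ F ∈ vanishingIdeal ℂ (bracketVariety Q K), ψ F = 0 := by
    intro F hF
    refine eq_zero_of_chartEval _ fun z hz => ?_
    rw [chartEval_aeval hz hY, ← coe_aeval_eq_eval]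
    exact hF _ (chartPoint_mem hQ hY hz)
  let φ : CoordinateRing (bracketVariety Q K) →+* ChartRing Y := Ideal.Quotient.lift _ ψ hψ
  have hX (α : Q) (hα : α ∈ Y) : ψ (X α - C K) * algebraMap _ _ (chartPoly Y α) =
      algebraMap ℂ _ (2 * K) := by
    have h1 : ψ (C K) = algebraMap _ _ (C K : MvPolynomial (indecomposables Y) ℂ) := by
      simp only [ψ, algHom_C]
      rw [IsScalarTower.algebraMap_apply ℂ (MvPolynomial (indecomposables Y) ℂ) (ChartRing Y)]
      rfl
    have h2 : ψ (X α) = chartCoord Y K α := by simp [ψ]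
    rw [map_sub, sub_mul, h1, h2, chartCoord_mul hα, ← map_mul, ← map_sub,
      IsScalarTower.algebraMap_apply ℂ (MvPolynomial (indecomposables Y) ℂ) (ChartRing Y),
      MvPolynomial.algebraMap_eq]
    congr 1
    rw [map_mul, map_ofNat]
    ring
  -- on the chart, both factors in `hX` are units
  have h2K : IsUnit (algebraMap ℂ (ChartRing Y) (2 * K)) :=
    (isUnit_iff_ne_zero.2 (mul_ne_zero two_ne_zero hK)).map _
  have hunit : ∀ α ∈ Y, IsUnit (ψ (X α - C K)) := fun α hα =>
    isUnit_of_mul_isUnit_left (hX α hα ▸ h2K)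
  have hfu : IsUnit (ψ (chartEquation Y K)) := by
    rw [chartEquation, map_prod]
    exact (IsUnit.prod_iff).2 fun α hα => hunit α (by simpa using hα)
  refine ⟨φ, ?_⟩
  let := φ.toAlgebra
  -- `b` is carried to the inverse of the equation of the complement of the chart
  obtain ⟨b, hb⟩ : ∃ b, ψ b * algebraMap _ _ (chartDenom Y) = 1 := by
    refine ⟨∏ α ∈ Y.toFinite.toFinset, C (2 * K)⁻¹ * (X α - C K), ?_⟩
    have hden : algebraMap _ (ChartRing Y) (chartDenom Y) =
        ∏ α ∈ Y.toFinite.toFinset, algebraMap _ (ChartRing Y) (chartPoly Y α) := map_prod _ _ _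
    rw [hden, map_prod, ← Finset.prod_mul_distrib]
    refine Finset.prod_eq_one fun α hα => ?_
    rw [map_mul, mul_assoc, hX α (by simpa using hα), algHom_C, ← map_mul,
      inv_mul_cancel₀ (mul_ne_zero two_ne_zero hK), map_one]
  -- `X p = (c p + K) / (c p - K)`, brought to the denominator `chartEquation`
  have hvar (p : indecomposables Y) : ∃ d : MvPolynomial Q ℂ,
      algebraMap (MvPolynomial (indecomposables Y) ℂ) (ChartRing Y) (X p) *
      ψ (chartEquation Y K) = ψ d := by
    classical
    have hp : (p : Q) ∈ Y.toFinite.toFinset := by simpa using p.2.1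
    refine ⟨(X (p : Q) + C K) * ∏ α ∈ Y.toFinite.toFinset.erase p, (X α - C K), ?_⟩
    have h1 := hX p p.2.1
    have h2 : chartPoly Y (p : Q) = X p - 1 := by
      rw [chartPoly, exponents_indecomposable hQ hY, X]
    have h3 : ψ (C K) + ψ (C K) = algebraMap ℂ (ChartRing Y) (2 * K) := by
      rw [← map_add, ← C_add, ← two_mul, algHom_C]
    rw [h2, map_sub (algebraMap _ _), map_one, map_sub] at h1
    rw [chartEquation, ← Finset.mul_prod_erase _ _ hp, map_mul, map_mul, map_add, map_sub]
    linear_combination ψ (∏ α ∈ Y.toFinite.toFinset.erase p, (X α - C K)) * (h1 - h3)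
  have hpoly (a : MvPolynomial (indecomposables Y) ℂ) :
      ∃ (n : ℕ) (d : MvPolynomial Q ℂ),
        algebraMap _ (ChartRing Y) a * ψ (chartEquation Y K) ^ n = ψ d := by
    induction a using MvPolynomial.induction_on with
    | C r =>
      refine ⟨0, C r, ?_⟩
      rw [pow_zero, mul_one, algHom_C,
        IsScalarTower.algebraMap_apply ℂ (MvPolynomial (indecomposables Y) ℂ) (ChartRing Y)]
      rfl
    | add p q hp hq =>
      obtain ⟨n, d, h⟩ := hp
      obtain ⟨m, e, h'⟩ := hq
      refine ⟨n + m, d * chartEquation Y K ^ m + e * chartEquation Y K ^ n, ?_⟩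
      simp only [map_add, map_mul, map_pow, ← h, ← h']
      ring
    | mul_X p i hp =>
      obtain ⟨n, d, h⟩ := hp
      obtain ⟨e, h'⟩ := hvar i
      refine ⟨n + 1, d * e, ?_⟩
      simp only [map_mul, ← h, ← h']
      ring
  refine IsLocalization.Away.mk _ hfu (fun t => ?_) fun x y hxy => ?_
  · obtain ⟨n, a, ha⟩ := IsLocalization.Away.surj (chartDenom Y) t
    obtain ⟨m, d, hd⟩ := hpoly a
    refine ⟨m, Ideal.Quotient.mk _ (d * b ^ n), ?_⟩
    change t * ψ (chartEquation Y K) ^ m = ψ (d * b ^ n)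
    rw [map_mul, ← hd, ← ha, map_pow]
    have hbn := congrArg (· ^ n) hb
    simp only [mul_pow, one_pow] at hbn
    linear_combination -t * ψ (chartEquation Y K) ^ m * hbn
  · obtain ⟨F, rfl⟩ := Ideal.Quotient.mk_surjective x
    obtain ⟨G, rfl⟩ := Ideal.Quotient.mk_surjective y
    change ψ F = ψ G at hxy
    refine ⟨1, ?_⟩
    rw [pow_one, ← map_mul, ← map_mul, Ideal.Quotient.eq]
    intro c hc
    change eval c (chartEquation Y K * F - chartEquation Y K * G) = 0
    by_cases hcY : ∀ α ∈ Y, c α ≠ K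
    · obtain ⟨z, hz, rfl⟩ := exists_chartPoint_eq hQ hY hK hc hcY
      have := congrArg (chartEval hz) hxy
      rw [chartEval_aeval hz hY, chartEval_aeval hz hY] at this
      simp only [map_sub, map_mul, this, sub_self]
    · have := not_not.1 (mt eval_chartEquation_ne_zero.1 hcY)
      simp only [map_sub, map_mul, this, zero_mul, sub_self]

end ChartRing

/-! ### Connectedness of a chart -/

section Connected

/-- The complement of a hypersurface in a complex affine space is connected: two of its points lie
on a complex line, which meets the hypersurface in finitely many points only. -/
lemma isPreconnected_eval_ne_zero {σ : Type*} (F : MvPolynomial σ ℂ) :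
    IsPreconnected {z : σ → ℂ | MvPolynomial.eval z F ≠ 0} := by
  refine isPreconnected_of_forall_pair fun z hz w hw => ?_
  let ℓ : ℂ → σ → ℂ := fun t i => z i + t * (w i - z i)
  let G : Polynomial ℂ := MvPolynomial.aeval
    (fun i => Polynomial.C (z i) + Polynomial.X * Polynomial.C (w i - z i)) F
  have hG (t : ℂ) : G.eval t = MvPolynomial.eval (ℓ t) F := by
    rw [← MvPolynomial.coe_aeval_eq_eval, ← Polynomial.coe_aeval_eq_eval]
    have : (Polynomial.aeval t).comp (MvPolynomial.aeval fun i =>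
        Polynomial.C (z i) + Polynomial.X * Polynomial.C (w i - z i)) =
        MvPolynomial.aeval (R := ℂ) (ℓ t) :=
      MvPolynomial.algHom_ext fun i => by simp [ℓ]
    exact AlgHom.congr_fun this F
  have h0 : ℓ 0 = z := by ext i; simp [ℓ]
  have h1 : ℓ 1 = w := by ext i; simp [ℓ]
  have hG0 : G ≠ 0 := by
    rintro h
    have := hG 0
    rw [h, h0, Polynomial.eval_zero] at this
    exact hz this.symm
  have hfin : {t | G.IsRoot t}.Finite := Polynomial.finite_setOfPred_isRoot hG0
  have hconn : IsConnected {t | G.IsRoot t}ᶜ :=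
    hfin.countable.isConnected_compl_of_one_lt_rank (by simp)
  have hℓ : Continuous ℓ := by fun_prop
  refine ⟨ℓ '' {t | G.IsRoot t}ᶜ, ?_, ⟨0, ?_, h0⟩, ⟨1, ?_, h1⟩,
    hconn.isPreconnected.image ℓ hℓ.continuousOn⟩
  · rintro _ ⟨t, ht, rfl⟩
    change MvPolynomial.eval (ℓ t) F ≠ 0
    rw [← hG]
    exact ht
  · change G.eval 0 ≠ 0
    rwa [hG, h0]
  · change G.eval 1 ≠ 0
    rwa [hG, h1]

variable {V : Type*} [AddCommGroup V] {Q : Set V} {B : V →+ V →+ ℝ} {Y : Set Q} {K : ℂ}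

/-- The point with `(c α + K) / (c α - K) = exp (f α)`. -/
lemma exists_mem_forall_ne (hK : K ≠ 0) (f : V →+ ℝ) (hf : ∀ α ∈ Q, f α ≠ 0) :
    ∃ c ∈ bracketVariety Q K, ∀ α, c α ≠ K := by
  have he {x : ℝ} (hx : x ≠ 0) : (Real.exp x : ℂ) - 1 ≠ 0 := by
    rw [sub_ne_zero]
    exact_mod_cast (Real.exp_eq_one_iff x).not.2 hx
  refine ⟨fun α => K * ((Real.exp (f α) + 1) / (Real.exp (f α) - 1)), ⟨?_, ?_⟩, fun α h => ?_⟩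
  · intro α β h
    have h1 := he (hf α α.2)
    have h2 := he (hf β β.2)
    have h3 : (Real.exp (f α) : ℂ) ≠ 0 := by exact_mod_cast (Real.exp_pos _).ne'
    simp only [h, map_neg, Real.exp_neg, Complex.ofReal_inv] at h2 ⊢
    have h4 : 1 - (Real.exp (f α) : ℂ) ≠ 0 := by rwa [← neg_ne_zero, neg_sub]
    field_simp
    ring
  · intro α β γ h
    have h1 := he (hf α α.2)
    have h2 := he (hf β β.2)
    have h3 := he (hf γ γ.2)
    simp only [h, map_add, Real.exp_add, Complex.ofReal_mul] at h3 ⊢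
    field_simp
    ring
  · have h1 := he (hf α α.2)
    field_simp at h
    have h2 : (2 : ℂ) = 0 := by linear_combination h
    norm_num at h2

lemma isPreconnected_chart (hQ : IsObtuseClosed Q B) (hY : IsSemilinear Y) (hK : K ≠ 0) :
    IsPreconnected {c | c ∈ bracketVariety Q K ∧ ∀ α ∈ Y, c α ≠ K} := by
  have : Finite Q := hQ.finite
  have himage : {c | c ∈ bracketVariety Q K ∧ ∀ α ∈ Y, c α ≠ K} =
      chartPoint Y K '' chartDomain Y := by
    ext c
    constructor
    · rintro ⟨hc, hcY⟩
      exact exists_chartPoint_eq hQ hY hK hc hcY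
    · rintro ⟨z, hz, rfl⟩
      exact ⟨chartPoint_mem hQ hY hz, fun α hα => chartPoint_ne hK hz hα⟩
  have hdom : chartDomain Y = {z | MvPolynomial.eval z (chartDenom Y) ≠ 0} := by
    ext z
    exact eval_chartDenom_ne_zero.symm
  rw [himage]
  refine (hdom ▸ isPreconnected_eval_ne_zero (chartDenom Y)).image _ ?_
  have hmono (α : Q) : Continuous fun z : indecomposables Y → ℂ => chartMonomial Y z α := by
    unfold chartMonomial Finsupp.prod
    fun_prop
  have hval : ∀ α ∈ Y, ContinuousOn (fun z => chartPoint Y K z α) (chartDomain Y) := by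
    intro α hα
    simp only [chartPoint_of_mem hα]
    have := (hmono α).continuousOn (s := chartDomain Y)
    refine continuousOn_const.mul ((this.add continuousOn_const).div
      (this.sub continuousOn_const) fun z hz => sub_ne_zero.2 (hz α hα))
  refine continuousOn_pi.2 fun α => ?_
  rcases hY.mem_or_neg_mem α with hα | ⟨β, hβ, h⟩
  · exact hval α hα
  · have h' : (α : V) = -β := by rw [h, neg_neg]
    simp only [chartPoint_neg hY h']
    exact (hval β hβ).neg

end Connected

/-! ### Global properties of the variety -/

section Abstract

variable {V : Type*} [AddCommGroup V] {Q : Set V} {B : V →+ V →+ ℝ} {K : ℂ}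

theorem isConnected_bracketVariety (hQ : IsObtuseClosed Q B) (f : V →+ ℝ)
    (hf : ∀ α ∈ Q, f α ≠ 0) (hK : K ≠ 0) : IsConnected (bracketVariety Q K) := by
  obtain ⟨c₀, hc₀, hne⟩ := exists_mem_forall_ne hK f hf
  refine ⟨⟨c₀, hc₀⟩, isPreconnected_of_forall c₀ fun c hc => ?_⟩
  obtain ⟨Y, hY, hcY⟩ := exists_isSemilinear_forall_ne hc hK hQ.neg_mem f hf
  exact ⟨{c | c ∈ bracketVariety Q K ∧ ∀ α ∈ Y, c α ≠ K}, fun _ h => h.1,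
    ⟨hc₀, fun α _ => hne α⟩, ⟨hc, hcY⟩, isPreconnected_chart hQ hY hK⟩

open MvPolynomial in
lemma mem_bracketVariety_of_vanishingIdeal {c : Q → ℂ}
    (hc : ∀ F ∈ vanishingIdeal ℂ (bracketVariety Q K), eval c F = 0) : c ∈ bracketVariety Q K := by
  refine ⟨fun α β h => ?_, fun α β γ h => ?_⟩
  · have := hc (X β + X α) fun d hd => by simp [hd.1 α β h]
    simp only [map_add, eval_X] at this
    exact eq_neg_of_add_eq_zero_left this
  · have := hc (X γ * (X α + X β) - (X α * X β + C (K ^ 2))) fun d hd => by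
      simp [hd.2 α β γ h]
    simpa [sub_eq_zero] using this

open MvPolynomial in
/-- The charts cover the spectrum of the coordinate ring, because by the Nullstellensatz its
maximal ideals are points of the variety. -/
lemma exists_chartEquation_notMem (hQ : IsObtuseClosed Q B) (f : V →+ ℝ)
    (hf : ∀ α ∈ Q, f α ≠ 0) (hK : K ≠ 0) [Finite Q]
    (p : Ideal (CoordinateRing (bracketVariety Q K))) [p.IsPrime] :
    ∃ Y : Set Q, IsSemilinear Y ∧ Ideal.Quotient.mk _ (chartEquation Y K) ∉ p := by
  obtain ⟨m, hm, hpm⟩ := p.exists_le_maximal Ideal.IsPrime.ne_top'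
  have hm' := Ideal.comap_isMaximal_of_surjective
    (Ideal.Quotient.mk (vanishingIdeal ℂ (bracketVariety Q K))) Ideal.Quotient.mk_surjective (K := m)
  obtain ⟨c, hc⟩ := isMaximal_iff_eq_vanishingIdeal_singleton.1 hm'
  have hcm (F : MvPolynomial Q ℂ) : Ideal.Quotient.mk _ F ∈ m ↔ eval c F = 0 := by
    rw [← Ideal.mem_comap, hc, mem_vanishingIdeal_singleton_iff]
    rfl
  have hcX : c ∈ bracketVariety Q K := mem_bracketVariety_of_vanishingIdeal fun F hF => by
    rw [← hcm, Ideal.Quotient.eq_zero_iff_mem.2 hF]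
    exact zero_mem _
  obtain ⟨Y, hY, hcY⟩ := exists_isSemilinear_forall_ne hcX hK hQ.neg_mem f hf
  exact ⟨Y, hY, fun h => eval_chartEquation_ne_zero.2 hcY ((hcm _).1 (hpm h))⟩

theorem isRegularRing_coordinateRing (hQ : IsObtuseClosed Q B) (f : V →+ ℝ)
    (hf : ∀ α ∈ Q, f α ≠ 0) (hK : K ≠ 0) :
    IsRegularRing (CoordinateRing (bracketVariety Q K)) := by
  have : Finite Q := hQ.finite
  refine isRegularRing_iff.2 fun p hp => ?_
  obtain ⟨Y, hY, hYp⟩ := exists_chartEquation_notMem hQ f hf hK p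
  obtain ⟨φ, hφ⟩ := exists_isLocalization_chartRing hQ hY hK
  let := φ.toAlgebra
  exact isRegularLocalRing_atPrime_of_chart (A := MvPolynomial (indecomposables Y) ℂ)
    (T := ChartRing Y) (g := chartDenom Y) p hYp

theorem ringKrullDim_coordinateRing (hQ : IsObtuseClosed Q B) (f : V →+ ℝ)
    (hf : ∀ α ∈ Q, f α ≠ 0) (hK : K ≠ 0) {Y P : Set Q} (hY : IsSemilinear Y)
    (hP : IsSimpleSet Y P) :
    ringKrullDim (CoordinateRing (bracketVariety Q K)) = P.ncard := by
  have : Finite Q := hQ.finite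
  rw [hP.eq_indecomposables hQ hY]
  refine le_antisymm ((ringKrullDim_le_iff_height_le _).2 fun p hp => ?_) ?_
  · obtain ⟨Y', hY', hYp⟩ := exists_chartEquation_notMem hQ f hf hK p
    obtain ⟨φ, hφ⟩ := exists_isLocalization_chartRing hQ hY' hK
    let := φ.toAlgebra
    refine (height_le_of_chart (A := MvPolynomial (indecomposables Y') ℂ)
      (T := ChartRing Y') (g := chartDenom Y') p hYp).trans ?_
    rw [MvPolynomial.ringKrullDim_of_isNoetherianRing, ringKrullDim_eq_zero_of_field, zero_add,
      Nat.card_coe_set_eq, hY.ncard_indecomposables hQ, hY'.ncard_indecomposables hQ]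
  · obtain ⟨c₀, hc₀, hne⟩ := exists_mem_forall_ne hK f hf
    obtain ⟨z, hz, -⟩ := exists_chartPoint_eq hQ hY hK hc₀ fun α _ => hne α
    obtain ⟨φ, hφ⟩ := exists_isLocalization_chartRing hQ hY hK
    let := φ.toAlgebra
    obtain ⟨m, hm, hmz, hh⟩ := exists_isMaximal_height_eq z
    rw [← Nat.card_coe_set_eq, ← hh]
    exact height_le_ringKrullDim_of_chart (T := ChartRing Y) (g := chartDenom Y)
      (f := Ideal.Quotient.mk _ (chartEquation Y K)) m
      fun h => eval_chartDenom_ne_zero.2 hz (hmz _ h)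

end Abstract

/-! ### Application to quasiroots -/

section Quasiroots

lemma leviRoots_subset {𝔤 : Type*} [LieRing 𝔤] [LieAlgebra ℂ 𝔤] [FiniteDimensional ℂ 𝔤]
    [LieAlgebra.IsSimple ℂ 𝔤] (𝔥 : LieSubalgebra ℂ 𝔤) [𝔥.IsCartanSubalgebra]
    (𝔩 : LieSubalgebra ℂ 𝔤) :
    leviRoots 𝔥 𝔩 ⊆ Set.range (IsKilling.rootSystem 𝔥).root :=
  Set.image_subset_range _ _

/-- Some additive functional does not vanish on a given finite set of nonzero vectors. -/
lemma exists_addMonoidHom_forall_ne_zero {V : Type*} [AddCommGroup V] [Module ℂ V] {Q : Set V}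
    (hQ : Q.Finite) (h0 : (0 : V) ∉ Q) : ∃ f : V →+ ℝ, ∀ α ∈ Q, f α ≠ 0 := by
  have : Finite Q := hQ
  let _ : Module ℝ V := Module.compHom V (algebraMap ℝ ℂ)
  obtain ⟨f, hf⟩ := Module.exists_dual_forall_apply_ne_zero (K := ℝ) (fun α : Q => (α : V))
    fun α h => h0 (h ▸ α.2)
  exact ⟨f.toAddMonoidHom, fun α hα => hf ⟨α, hα⟩⟩

end Quasiroots

end PhiBracket

end

theorem mainTheorem11 {𝔤 : Type*} [LieRing 𝔤] [LieAlgebra ℂ 𝔤] [FiniteDimensional ℂ 𝔤]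
    [LieAlgebra.IsSimple ℂ 𝔤]
    (𝔥 : LieSubalgebra ℂ 𝔤) [𝔥.IsCartanSubalgebra]
    (𝔩 : LieSubalgebra ℂ 𝔤) (h𝔩 : PhiBracket.IsLevi 𝔥 𝔩)
    (K : ℂ) (hK : K ≠ 0) :
    (∀ c ∈ PhiBracket.bracketVariety (PhiBracket.quasiroots 𝔥 𝔩) K,
      ∃ Y P : Set (PhiBracket.quasiroots 𝔥 𝔩),
        PhiBracket.IsSemilinear Y ∧ PhiBracket.IsSimpleSet Y P ∧
          PhiBracket.IsObtainedRecursively K Y P c) ∧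
    IsRegularRing (PhiBracket.CoordinateRing
      (PhiBracket.bracketVariety (PhiBracket.quasiroots 𝔥 𝔩) K)) ∧
    IsConnected (PhiBracket.bracketVariety (PhiBracket.quasiroots 𝔥 𝔩) K) ∧
    ∀ Y P : Set (PhiBracket.quasiroots 𝔥 𝔩),
      PhiBracket.IsSemilinear Y → PhiBracket.IsSimpleSet Y P →
        ringKrullDim (PhiBracket.CoordinateRing
          (PhiBracket.bracketVariety (PhiBracket.quasiroots 𝔥 𝔩) K)) = P.ncard := by
  obtain ⟨B, hQ⟩ : ∃ B, PhiBracket.IsObtuseClosed (PhiBracket.quasiroots 𝔥 𝔩) B :=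
    PhiBracket.exists_isObtuseClosed_quotientSet (IsKilling.rootSystem 𝔥)
      (PhiBracket.leviRoots_subset 𝔥 𝔩)
  obtain ⟨f, hf⟩ := PhiBracket.exists_addMonoidHom_forall_ne_zero hQ.finite hQ.zero_notMem
  refine ⟨fun c hc => ?_, PhiBracket.isRegularRing_coordinateRing hQ f hf hK,
    PhiBracket.isConnected_bracketVariety hQ f hf hK,
    fun Y P hY hP => PhiBracket.ringKrullDim_coordinateRing hQ f hf hK hY hP⟩
  obtain ⟨Y, hY, hcY⟩ := PhiBracket.exists_isSemilinear_forall_ne hc hK hQ.neg_mem f hf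
  exact ⟨Y, PhiBracket.indecomposables Y, hY, hY.isSimpleSet hQ,
    PhiBracket.isObtainedRecursively hQ hc hY hcY⟩
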